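/- Let $G$ be a finite simple graph. A set $S \subseteq V(G)$ is *dominating* if every vertex of $G$ not in $S$ is adjacent to some vertex of $S$. The *TARS-graph* $\varepsilon(G)$ is the simple graph whose vertices are the dominating sets of $G$, where two dominating sets $X$ and $Y$ are adjacent if and only if 1. $Y$ is obtained from $X$ by adding or deleting a single vertex of $G$ (token addition/removal); or 2. there are vertices $u \in X$ and $v \in Y \setminus X$ that are adjacent in $G$ and satisfy $Y = (X \cup \{v\}) \setminus \{u\}$ (token sliding). A graph on $n$ vertices is *pancyclic* if it contains a cycle of length $\ell$ for every integer $\ell$ with $3 \le \ell \le n$. **Corollary.** For every finite tree $T$, the TARS-graph $\varepsilon(T)$ is pancyclic. -/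

import Mathlib

namespace SimpleGraph

/-- A set `S` of vertices dominates `G` if every vertex outside `S` has a neighbour in `S`. -/
def IsDominating {V : Type*} (G : SimpleGraph V) (S : Finset V) : Prop :=
  ∀ v, v ∉ S → ∃ u ∈ S, G.Adj u v

/-- Token addition/removal: `Y` is obtained from `X` by adding or deleting a single vertex. -/
def TokenAddRemove {V : Type*} [DecidableEq V] (X Y : Finset V) : Prop :=
  (∃ v, v ∉ X ∧ Y = insert v X) ∨ (∃ v, v ∈ X ∧ Y = X.erase v)

/-- Token sliding: `Y = (X ∪ {v}) \ {u}` for adjacent vertices `u ∈ X` and `v ∈ Y \ X`. -/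
def TokenSlide {V : Type*} [DecidableEq V] (G : SimpleGraph V) (X Y : Finset V) : Prop :=
  ∃ u v, u ∈ X ∧ v ∈ Y \ X ∧ G.Adj u v ∧ Y = (insert v X).erase u

theorem TokenAddRemove.symm {V : Type*} [DecidableEq V] {X Y : Finset V}
    (h : TokenAddRemove X Y) : TokenAddRemove Y X := by
  rcases h with ⟨v, hv, rfl⟩ | ⟨v, hv, rfl⟩
  · exact Or.inr ⟨v, Finset.mem_insert_self v X, (Finset.erase_insert hv).symm⟩
  · exact Or.inl ⟨v, Finset.notMem_erase v X, (Finset.insert_erase hv).symm⟩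

theorem TokenSlide.symm {V : Type*} [DecidableEq V] {G : SimpleGraph V} {X Y : Finset V}
    (h : G.TokenSlide X Y) : G.TokenSlide Y X := by
  obtain ⟨u, v, hu, hv, huv, rfl⟩ := h
  have hvX : v ∉ X := (Finset.mem_sdiff.mp hv).2
  refine ⟨v, u, (Finset.mem_sdiff.mp hv).1, by simp [hu], huv.symm, ?_⟩
  rw [Finset.insert_erase (Finset.mem_insert_of_mem hu), Finset.erase_insert hvX]

/-- The TARS-graph of `G`: its vertices are the dominating sets of `G`, and two of them are
adjacent if one is obtained from the other by token addition/removal or by token sliding. -/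
def tarsGraph {V : Type*} [DecidableEq V] (G : SimpleGraph V) :
    SimpleGraph {S : Finset V // G.IsDominating S} where
  Adj X Y := TokenAddRemove X.1 Y.1 ∨ G.TokenSlide X.1 Y.1
  symm := ⟨fun _ _ h => h.imp TokenAddRemove.symm TokenSlide.symm⟩
  loopless := ⟨by
    rintro ⟨X, _⟩ ((⟨v, hv, h⟩ | ⟨v, hv, h⟩) | ⟨u, v, _, hv, _, _⟩)
    · exact hv (h ▸ Finset.mem_insert_self v X)
    · exact Finset.notMem_erase v X (h ▸ hv)
    · simp at hv⟩

/-- A finite graph on `n` vertices is pancyclic if it has a cycle of every length `ℓ` with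
`3 ≤ ℓ ≤ n`. -/
def IsPancyclic {W : Type*} [Finite W] (G : SimpleGraph W) : Prop :=
  ∀ ℓ : ℕ, 3 ≤ ℓ → ℓ ≤ Nat.card W → ∃ (w : W) (c : G.Walk w w), c.IsCycle ∧ c.length = ℓ

end SimpleGraph

/-! Choose a vertex `v` all of whose neighbours, except possibly one vertex `w`, are leaves, with at
least one such leaf. Let `L` be the set of these leaves and let the core be what is left without `v`
and `L`. A dominating set avoiding `v` must contain `L`, so it is `Q ∪ L` with `Q` dominating the
core. A dominating set containing `v` meets the core in a set that can fail to dominate only at `w`;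
adding `w` in that case gives again a dominating set `Q` of the core. Hence the dominating sets
split into columns, one for each `Q`: a point `z = Q ∪ L`, and a cube of sets containing `v` whose
coordinates are `L`, sometimes with `w`.

In a column, `z` is adjacent to the top of the cube (add `v`) and to every coatom (slide onto `v`).
The top and a coatom are joined by paths of all even orders (`hasPath_powerset`); dropping the top
leaves paths of odd order that start at a neighbour of `z`. So a single column has cycles of all
lengths from 3 to its size.

Inductively, the dominating sets of the core have a Hamiltonian path. Columns consecutive on it are
linked at `z`, at the top and at a fixed coatom, so a cycle can go out through the cubes and return
along the points `z` (`ColumnSystem.exists_cycle`). The longest such cycle is Hamiltonian, which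
feeds the induction. The core need not be connected, so the induction runs over vertex subsets of an
acyclic graph. -/

/-! ### Paths in a relation, recorded by end points and number of vertices -/

/-- There is an `R`-path from `x` to `y` on `n` distinct vertices, all of them in `K`. -/
def HasPath {α : Type*} (R : α → α → Prop) (K : Set α) (x y : α) (n : ℕ) : Prop :=
  ∃ l : List α, l.IsChain R ∧ l.Nodup ∧ l.head? = some x ∧ l.getLast? = some y ∧
    l.length = n ∧ ∀ a ∈ l, a ∈ K

namespace HasPath

variable {α β : Type*} {R : α → α → Prop} {K K' : Set α} {x y x' y' : α} {m n : ℕ}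

theorem singleton (R : α → α → Prop) (x : α) : HasPath R {x} x x 1 :=
  ⟨[x], by simp⟩

theorem mono (h : HasPath R K x y n) (hK : K ⊆ K') : HasPath R K' x y n := by
  obtain ⟨l, h1, h2, h3, h4, h5, h6⟩ := h
  exact ⟨l, h1, h2, h3, h4, h5, fun a ha => hK (h6 a ha)⟩

theorem left_mem (h : HasPath R K x y n) : x ∈ K := by
  obtain ⟨l, -, -, h3, -, -, h6⟩ := h
  exact h6 x (List.mem_of_head? h3)

theorem append (h : HasPath R K x y m) (hR : R y x') (h' : HasPath R K' x' y' n)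
    (hK : Disjoint K K') : HasPath R (K ∪ K') x y' (m + n) := by
  obtain ⟨l, h1, h2, h3, h4, h5, h6⟩ := h
  obtain ⟨l', h1', h2', h3', h4', h5', h6'⟩ := h'
  refine ⟨l ++ l', ?_, ?_, ?_, ?_, ?_, ?_⟩
  · refine h1.append h1' ?_
    intro a ha b hb
    simp_all
  · refine h2.append h2' ?_
    intro a ha hb
    exact Set.disjoint_left.mp hK (h6 a ha) (h6' a hb)
  · simp [h3]
  · simp [h4']
  · simp [h5, h5']
  · intro a ha
    rcases List.mem_append.mp ha with ha | ha
    · exact Or.inl (h6 a ha)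
    · exact Or.inr (h6' a ha)

theorem symm (hR : ∀ a b, R a b → R b a) (h : HasPath R K x y n) : HasPath R K y x n := by
  obtain ⟨l, h1, h2, h3, h4, h5, h6⟩ := h
  refine ⟨l.reverse, ?_, by simpa using h2, by simpa using h4, by simpa using h3,
    by simpa using h5, by simpa using h6⟩
  rw [List.isChain_reverse]
  exact h1.imp hR

/-- Split off the first vertex of a path. -/
theorem uncons (h : HasPath R K x y (n + 2)) :
    ∃ x', R x x' ∧ HasPath R (K \ {x}) x' y (n + 1) := by
  obtain ⟨l, h1, h2, h3, h4, h5, h6⟩ := h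
  match l, h5 with
  | a :: b :: l, h5 =>
    obtain rfl : a = x := by simpa using h3
    rw [List.isChain_cons_cons] at h1
    refine ⟨b, h1.1, b :: l, h1.2, h2.of_cons, by simp, by simpa using h4, by simpa using h5, ?_⟩
    intro c hc
    refine ⟨h6 c (List.mem_cons_of_mem _ hc), ?_⟩
    rintro rfl
    exact (List.nodup_cons.mp h2).1 hc

theorem map {S : β → β → Prop} (f : α → β) (hf : Set.InjOn f K)
    (hRS : ∀ a ∈ K, ∀ b ∈ K, R a b → S (f a) (f b)) (h : HasPath R K x y n) :
    HasPath S (f '' K) (f x) (f y) n := by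
  obtain ⟨l, h1, h2, h3, h4, h5, h6⟩ := h
  refine ⟨l.map f, ?_, ?_, by simp [h3], by simp [h4], by simpa using h5, ?_⟩
  · rw [List.isChain_map]
    exact h1.imp_of_mem_imp fun a b ha hb hab => hRS a (h6 a ha) b (h6 b hb) hab
  · exact h2.map_on fun a ha b hb hab => hf (h6 a ha) (h6 b hb) hab
  · intro a ha
    obtain ⟨b, hb, rfl⟩ := List.mem_map.mp ha
    exact ⟨b, h6 b hb, rfl⟩

end HasPath

/-! ### Paths in a cube -/

namespace SimpleGraph

/-- In a cube, the top and each coatom are joined by paths of all even orders. -/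
theorem hasPath_powerset {V : Type*} [DecidableEq V] (d : ℕ) :
    ∀ (A : Finset V), A.card = d → ∀ l ∈ A, ∀ n, Even n → 2 ≤ n → n ≤ 2 ^ d →
      HasPath TokenAddRemove {X | X ⊆ A} A (A.erase l) n := by
  induction d with
  | zero =>
    intro A hA l hl
    simp_all
  | succ d ih =>
    intro A hA l hl n hn hn2 hnd
    by_cases hne : A.erase l = ∅
    · have hAl : A = {l} := by
        rw [← Finset.insert_erase hl, hne]; rfl
      have hd : d = 0 := by simpa [hAl] using hA.symm
      obtain rfl : n = 1 + 1 := by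
        subst hd; simp at hnd; omega
      refine ((HasPath.singleton _ A).append (x' := A.erase l) (Or.inr ⟨l, hl, rfl⟩)
        (HasPath.singleton _ _) ?_).mono ?_
      · simp only [Set.disjoint_singleton]
        intro h
        exact Finset.notMem_erase l A (h ▸ hl)
      · rintro X (rfl | rfl)
        · exact Finset.Subset.refl _
        · exact Finset.erase_subset _ _
    · obtain ⟨a, ha⟩ := Finset.nonempty_of_ne_empty hne
      obtain ⟨hal, haA⟩ := Finset.mem_erase.mp ha
      -- As `a ≠ l`, both ends contain `a` and lie in the upper half of the cube, the copy of the
      -- subsets of `B` under `insert a`.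
      set B := A.erase a with hB
      have hAB : insert a B = A := Finset.insert_erase haA
      have haB : a ∉ B := Finset.notMem_erase a A
      have hBd : B.card = d := by rw [hB, Finset.card_erase_of_mem haA, hA]; rfl
      have hlB : l ∈ B := Finset.mem_erase.mpr ⟨hal.symm, hl⟩
      have hd : d ≠ 0 := by
        rintro rfl
        exact Finset.card_ne_zero_of_mem hlB hBd
      have h2d : Even (2 ^ d) := (Nat.even_pow.mpr ⟨even_two, hd⟩)
      have h2d' : 2 ≤ 2 ^ d := Nat.le_self_pow hd 2
      have hinj : ∀ K : Set (Finset V), K ⊆ {X | X ⊆ B} →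
          Set.InjOn (fun X => insert a X) K := by
        intro K hK X hX Y hY hXY
        have h := congrArg (fun Z => Z.erase a) hXY
        simpa [Finset.erase_insert (fun h => haB (hK hX h)),
          Finset.erase_insert (fun h => haB (hK hY h))] using h
      have hadj : ∀ X, X ⊆ B → ∀ Y, Y ⊆ B → TokenAddRemove X Y →
          TokenAddRemove (insert a X) (insert a Y) := by
        rintro X hX Y hY (⟨u, hu, rfl⟩ | ⟨u, hu, rfl⟩)
        · refine Or.inl ⟨u, ?_, Finset.insert_comm _ _ _⟩
          have : u ≠ a := by
            rintro rfl
            exact haB (hY (Finset.mem_insert_self _ _))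
          simp [this, hu]
        · refine Or.inr ⟨u, Finset.mem_insert_of_mem hu, ?_⟩
          have : u ≠ a := by
            rintro rfl
            exact haB (hX hu)
          rw [Finset.erase_insert_of_ne this.symm]
      have herase : insert a (B.erase l) = A.erase l := by
        rw [← hAB, Finset.erase_insert_of_ne hal]
      rcases le_or_gt n (2 ^ d) with hnd' | hnd'
      · have h := (ih B hBd l hlB n hn hn2 hnd').map (S := TokenAddRemove)
          (fun X => insert a X) (hinj _ subset_rfl) (fun X hX Y hY => hadj X hX Y hY)
        simp only [hAB, herase] at h
        refine h.mono ?_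
        rintro _ ⟨X, hX, rfl⟩
        rw [← hAB]
        exact Finset.insert_subset_insert _ hX
      -- Take a Hamiltonian path of the half-cube from `B` to `B.erase l`, with second vertex
      -- `B.erase l'`. Its lift is cut after the top `A`, and a detour from `B` to `B.erase l'` in
      -- the lower half, on `n - 2 ^ d` vertices, is inserted there.
      · obtain ⟨k, hk⟩ : ∃ k, 2 ^ d = k + 2 := ⟨2 ^ d - 2, by omega⟩
        have hfull := ih B hBd l hlB (k + 2) (hk ▸ h2d) (by omega) hk.ge
        obtain ⟨X, hBX, hX⟩ := hfull.uncons
        have hXB : X ⊆ B := hX.left_mem.1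
        obtain ⟨l', hl', rfl⟩ : ∃ l' ∈ B, X = B.erase l' := by
          rcases hBX with ⟨u, hu, rfl⟩ | ⟨u, hu, rfl⟩
          · exact absurd (hXB (Finset.mem_insert_self _ _)) hu
          · exact ⟨u, hu, rfl⟩
        have hlow := ih B hBd l' hl' (n - 2 ^ d) (hn.tsub h2d)
          (by obtain ⟨c, hc⟩ := hn; obtain ⟨e, he⟩ := h2d; omega)
          (by rw [pow_succ] at hnd; omega)
        have hup := hX.map (S := TokenAddRemove) (fun X => insert a X)
          (hinj _ Set.sdiff_subset) (fun X hX Y hY => hadj X hX.1 Y hY.1)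
        simp only [herase] at hup
        have h1 := (HasPath.singleton TokenAddRemove A).append
          (Or.inr ⟨a, haA, rfl⟩) hlow ?_
        · have h2 := h1.append (Or.inl ⟨a, fun h => haB (Finset.mem_of_mem_erase h), rfl⟩) hup ?_
          · have hcount : 1 + (n - 2 ^ d) + (k + 1) = n := by omega
            rw [hcount] at h2
            refine h2.mono ?_
            rintro Y ((rfl | hY) | ⟨Y, hY, rfl⟩)
            · exact Finset.Subset.refl _
            · exact Finset.Subset.trans hY (Finset.erase_subset _ _)
            · change insert a Y ⊆ A
              rw [← hAB]
              exact Finset.insert_subset_insert _ hY.1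
          · rw [Set.disjoint_left]
            rintro _ hY ⟨Y, hY', rfl⟩
            rcases hY with hY | hY
            · refine hY'.2 ?_
              have h : insert a Y = insert a B := by rw [hAB]; exact hY
              exact hinj _ subset_rfl hY'.1 (Finset.Subset.refl B) h
            · exact haB (hY (Finset.mem_insert_self _ _))
        · rw [Set.disjoint_singleton_left]
          intro h
          exact haB (h haA)

end SimpleGraph

/-! ### Paths and cycles in a strip of columns -/

/-- A family of columns, each consisting of a vertex `z i` and a set `K i` of `N i` vertices with
two distinguished elements `t i` and `b i`. Columns with related indices are linked at `z`, `t`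
and `b`. -/
structure ColumnSystem {ι α : Type*} (r : ι → ι → Prop) (R : α → α → Prop) (I : Set ι) where
  z : ι → α
  t : ι → α
  b : ι → α
  K : ι → Set α
  N : ι → ℕ
  symm : ∀ x y, R x y → R y x
  even_N : ∀ i ∈ I, Even (N i)
  two_le_N : ∀ i ∈ I, 2 ≤ N i
  z_notMem : ∀ i ∈ I, z i ∉ K i
  pairwise_disjoint : ∀ i ∈ I, ∀ j ∈ I, i ≠ j →
    Disjoint (insert (z i) (K i)) (insert (z j) (K j))
  z_adj_t : ∀ i ∈ I, R (z i) (t i)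
  z_adj_b : ∀ i ∈ I, R (z i) (b i)
  adj_z : ∀ i ∈ I, ∀ j ∈ I, r i j → R (z i) (z j)
  adj_t : ∀ i ∈ I, ∀ j ∈ I, r i j → R (t i) (t j)
  adj_b : ∀ i ∈ I, ∀ j ∈ I, r i j → R (b i) (b j)
  path_t_b : ∀ i ∈ I, ∀ n, Even n → 2 ≤ n → n ≤ N i → HasPath R (K i) (t i) (b i) n
  path_to_b : ∀ i ∈ I, ∀ n, 1 ≤ n → n ≤ N i → ∃ h, R (z i) h ∧ HasPath R (K i) h (b i) n

namespace ColumnSystem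

variable {ι α : Type*} {r : ι → ι → Prop} {R : α → α → Prop} {I : Set ι}
  (C : ColumnSystem r R I)

/-- The vertices of the columns with index in a list. -/
def region (is : List ι) : Set α :=
  {x | ∃ i ∈ is, x ∈ insert (C.z i) (C.K i)}

/-- The number of vertices of the columns with index in a list. -/
def size (is : List ι) : ℕ := (is.map fun i => C.N i + 1).sum

theorem disjoint_region {i : ι} {is : List ι} (hi : i ∈ I) (his : ∀ j ∈ is, j ∈ I)
    (hnot : i ∉ is) : Disjoint (insert (C.z i) (C.K i)) (C.region is) := by
  rw [Set.disjoint_left]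
  rintro x hx ⟨j, hj, hxj⟩
  refine Set.disjoint_left.mp (C.pairwise_disjoint i hi j (his j hj) ?_) hx hxj
  rintro rfl
  exact hnot hj

/-- A path which runs through a column from one side to the other, and then through a set
disjoint from that column before returning to `z i`. -/
theorem path_through {i : ι} (hi : i ∈ I) {s s' p q : α} {m n : ℕ} {M : Set α}
    (hs : HasPath R (C.K i) s s' m) (hsp : R s' p) (hM : HasPath R M p q n) (hq : R q (C.z i))
    (hdisj : Disjoint (insert (C.z i) (C.K i)) M) :
    HasPath R (insert (C.z i) (C.K i) ∪ M) s (C.z i) (m + n + 1) := by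
  refine ((hs.append hsp hM ?_).append hq (HasPath.singleton R (C.z i)) ?_).mono ?_
  · exact hdisj.mono_left (Set.subset_insert _ _)
  · rw [Set.disjoint_singleton_right]
    rintro (h | h)
    · exact C.z_notMem i hi h
    · exact Set.disjoint_left.mp hdisj (Set.mem_insert _ _) h
  · rintro x ((h | h) | rfl)
    · exact Or.inl (Or.inr h)
    · exact Or.inr h
    · exact Or.inl (Set.mem_insert _ _)

/-- A path from one side of a column, possibly across it, to its vertex `z i`. -/
theorem path_in_column {i : ι} (hi : i ∈ I) {s s' : α} {m : ℕ}
    (hs : HasPath R (C.K i) s s' m) (hz : R s' (C.z i)) :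
    HasPath R (insert (C.z i) (C.K i)) s (C.z i) (m + 1) := by
  refine (hs.append hz (HasPath.singleton R (C.z i)) ?_).mono ?_
  · rw [Set.disjoint_singleton_right]
    exact C.z_notMem i hi
  · rintro x (h | rfl)
    · exact Or.inr h
    · exact Set.mem_insert _ _

/-- From either side of the first column there are paths through the strip to its vertex `z i`;
the orders which occur leave only gaps of length one. -/
theorem exists_path_strip (is : List ι) : ∀ i, (∀ j ∈ i :: is, j ∈ I) → (i :: is).Nodup →
    (i :: is).IsChain r → ∀ n, 1 ≤ n → n ≤ C.size (i :: is) → ∀ s, (s = C.t i ∨ s = C.b i) →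
      ∃ n', n ≤ n' ∧ n' ≤ n + 1 ∧ n' ≤ C.size (i :: is) ∧
        HasPath R (C.region (i :: is)) s (C.z i) n' := by
  -- Short paths stay in the first column: an even path across the cube, then `z i`, gives every odd
  -- order from 3 to `N i + 1`. The only other order needed is 2, from `s` directly to `z i`.
  have key : ∀ i (is : List ι), (∀ j ∈ i :: is, j ∈ I) → ∀ n, 1 ≤ n → n ≤ C.N i + 1 →
      ∀ s, (s = C.t i ∨ s = C.b i) → ∃ n', n ≤ n' ∧ n' ≤ n + 1 ∧ n' ≤ C.size (i :: is) ∧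
        HasPath R (C.region (i :: is)) s (C.z i) n' := by
    intro i is hI n hn hnN s hs
    have hi : i ∈ I := hI i (by simp)
    have hsub : insert (C.z i) (C.K i) ⊆ C.region (i :: is) := fun x hx => ⟨i, by simp, hx⟩
    have hsize : C.N i + 1 ≤ C.size (i :: is) := by simp [size]
    have hN := C.even_N i hi
    have hN2 := C.two_le_N i hi
    have hsz : R s (C.z i) := by
      rcases hs with rfl | rfl
      · exact C.symm _ _ (C.z_adj_t i hi)
      · exact C.symm _ _ (C.z_adj_b i hi)
    have hsK : s ∈ C.K i := by
      have h := C.path_t_b i hi 2 even_two le_rfl hN2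
      rcases hs with rfl | rfl
      · exact h.left_mem
      · exact (h.symm C.symm).left_mem
    obtain ⟨s', hs', hpath⟩ : ∃ s', R s' (C.z i) ∧ ∀ n, Even n → 2 ≤ n → n ≤ C.N i →
        HasPath R (C.K i) s s' n := by
      rcases hs with rfl | rfl
      · exact ⟨C.b i, C.symm _ _ (C.z_adj_b i hi), C.path_t_b i hi⟩
      · exact ⟨C.t i, C.symm _ _ (C.z_adj_t i hi),
          fun n h1 h2 h3 => (C.path_t_b i hi n h1 h2 h3).symm C.symm⟩
    rcases eq_or_lt_of_le hn with rfl | hn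
    · have hone : HasPath R (C.K i) s s 1 :=
        (HasPath.singleton R s).mono (Set.singleton_subset_iff.mpr hsK)
      exact ⟨2, by omega, by omega, by omega, (C.path_in_column hi hone hsz).mono hsub⟩
    · rcases Nat.even_or_odd n with he | ho
      · have hle : n ≤ C.N i := by
          obtain ⟨c, hc⟩ := he
          obtain ⟨e, he⟩ := hN
          omega
        exact ⟨n + 1, by omega, by omega, by omega,
          (C.path_in_column hi (hpath n he hn hle) hs').mono hsub⟩
      · obtain ⟨c, rfl⟩ := ho
        exact ⟨2 * c + 1, by omega, by omega, by omega,
          (C.path_in_column hi (hpath (2 * c) (by simp) (by omega) (by omega)) hs').mono hsub⟩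
  induction is with
  | nil =>
    intro i hI _ _ n hn hnN
    exact key i [] hI n hn (by simpa [size] using hnN)
  | cons j js ih =>
    intro i hI hnd hch n hn hnN s hs
    rcases le_or_gt n (C.N i + 1) with hle | hgt
    · exact key i (j :: js) hI n hn hle s hs
    · have hi : i ∈ I := hI i (by simp)
      have hj : j ∈ I := hI j (by simp)
      have hI' : ∀ k ∈ j :: js, k ∈ I := fun k hk => hI k (List.mem_cons_of_mem _ hk)
      rw [List.isChain_cons_cons] at hch
      have hsize : C.size (i :: j :: js) = C.N i + 1 + C.size (j :: js) := by simp [size]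
      have hdisj := C.disjoint_region hi hI' (List.nodup_cons.mp hnd).1
      have hzz := C.symm _ _ (C.adj_z i hi j hj hch.1)
      have hsub : insert (C.z i) (C.K i) ∪ C.region (j :: js) ⊆ C.region (i :: j :: js) := by
        rintro x (hx | ⟨k, hk, hx⟩)
        · exact ⟨i, by simp, hx⟩
        · exact ⟨k, List.mem_cons_of_mem _ hk, hx⟩
      -- A long path uses up the whole cube, which switches sides, enters the next column on that
      -- side and comes back from `z j` to `z i`.
      have hcross := C.path_t_b i hi (C.N i) (C.even_N i hi) (C.two_le_N i hi) le_rfl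
      rcases hs with rfl | rfl
      · obtain ⟨n', h1, h2, h3, h4⟩ := ih j hI' hnd.of_cons hch.2 (n - (C.N i + 1)) (by omega)
          (by omega) (C.b j) (Or.inr rfl)
        exact ⟨C.N i + n' + 1, by omega, by omega, by omega,
          (C.path_through hi hcross (C.adj_b i hi j hj hch.1) h4 hzz hdisj).mono hsub⟩
      · obtain ⟨n', h1, h2, h3, h4⟩ := ih j hI' hnd.of_cons hch.2 (n - (C.N i + 1)) (by omega)
          (by omega) (C.t j) (Or.inl rfl)
        exact ⟨C.N i + n' + 1, by omega, by omega, by omega,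
          (C.path_through hi (hcross.symm C.symm) (C.adj_t i hi j hj hch.1) h4 hzz hdisj).mono
            hsub⟩

/-- A strip of columns has cycles of all lengths. -/
theorem exists_cycle (is : List ι) (hne : is ≠ []) (hI : ∀ j ∈ is, j ∈ I) (hnd : is.Nodup)
    (hch : is.IsChain r) (n : ℕ) (hn : 3 ≤ n) (hnN : n ≤ C.size is) :
    ∃ x y, R y x ∧ HasPath R (C.region is) x y n := by
  match is with
  | i :: js =>
    have hi : i ∈ I := hI i (by simp)
    rcases le_or_gt n (C.N i + 1) with hle | hgt
    -- The cycle is `z i` together with a path of order `n - 1` from a neighbour of `z i` to `b i`.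
    · obtain ⟨h, hzh, hpath⟩ := C.path_to_b i hi (n - 1) (by omega) (by omega)
      have hp := C.path_in_column hi (hpath.symm C.symm) (C.symm _ _ hzh)
      rw [Nat.sub_add_cancel (by omega)] at hp
      exact ⟨_, _, C.z_adj_b i hi, hp.mono fun x hx => ⟨i, by simp, hx⟩⟩
    · match js with
      | [] => simp [size] at hnN; omega
      | j :: js =>
        have hj : j ∈ I := hI j (by simp)
        have hI' : ∀ k ∈ j :: js, k ∈ I := fun k hk => hI k (List.mem_cons_of_mem _ hk)
        rw [List.isChain_cons_cons] at hch
        have hsize : C.size (i :: j :: js) = C.N i + 1 + C.size (j :: js) := by simp [size]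
        have hN2 := C.two_le_N i hi
        obtain ⟨n', h1, h2, h3, h4⟩ := C.exists_path_strip js j hI' hnd.of_cons hch.2
          (n - (C.N i + 1)) (by omega) (by omega) (C.b j) (Or.inr rfl)
        -- The strip overshoots its target by at most one, so the first cube must supply `N i` or `N
        -- i - 1` vertices. Both are possible because `path_to_b` has no parity restriction.
        obtain ⟨h, hzh, hpath⟩ := C.path_to_b i hi (n - 1 - n') (by omega) (by omega)
        have hp := C.path_through hi hpath (C.adj_b i hi j hj hch.1) h4
          (C.symm _ _ (C.adj_z i hi j hj hch.1))
          (C.disjoint_region hi hI' (List.nodup_cons.mp hnd).1)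
        have hcount : n - 1 - n' + n' + 1 = n := by omega
        rw [hcount] at hp
        refine ⟨_, _, hzh, hp.mono ?_⟩
        rintro x (hx | ⟨k, hk, hx⟩)
        · exact ⟨i, by simp, hx⟩
        · exact ⟨k, List.mem_cons_of_mem _ hk, hx⟩

end ColumnSystem

/-! ### Closing paths to cycles, and leaves of acyclic graphs -/

namespace SimpleGraph

/-- A path on at least three vertices whose ends are adjacent closes up to a cycle. -/
theorem exists_isCycle_of_hasPath {W : Type*} {G : SimpleGraph W} {K : Set W} {x y : W} {n : ℕ}
    (h : HasPath G.Adj K x y n) (hyx : G.Adj y x) (hn : 3 ≤ n) :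
    ∃ (w : W) (c : G.Walk w w), c.IsCycle ∧ c.length = n := by
  obtain ⟨l, h1, h2, h3, h4, h5, -⟩ := h
  have hne : l ≠ [] := by
    rintro rfl
    simp at h3
  have hx : l.head hne = x := by simpa [List.head?_eq_some_head hne] using h3
  have hy : l.getLast hne = y := by simpa [List.getLast?_eq_some_getLast hne] using h4
  have hlen := Walk.length_ofSupport hne h1
  have hpath : (Walk.ofSupport l hne h1).IsPath := by
    rw [Walk.isPath_def, Walk.support_ofSupport]
    exact h2
  refine ⟨_, .cons (by rw [hx, hy]; exact hyx) (Walk.ofSupport l hne h1), ?_, ?_⟩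
  · rw [Walk.isCycle_iff_isPath_tail_and_le_length]
    refine ⟨by simpa using hpath, ?_⟩
    rw [Walk.length_cons, hlen]
    omega
  · rw [Walk.length_cons, hlen]
    omega

variable {V : Type*} {G : SimpleGraph V}

/-- An acyclic graph with an edge inside `U` has a vertex with exactly one neighbour in `U`. -/
theorem IsAcyclic.exists_leaf_in (hG : G.IsAcyclic) (U : Finset V) {a b : V} (ha : a ∈ U)
    (hb : b ∈ U) (hab : G.Adj a b) :
    ∃ x ∈ U, ∃ y ∈ U, G.Adj x y ∧ ∀ z ∈ U, G.Adj x z → z = y := by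
  classical
  set H := G.induce (U : Set V) with hH
  have hHa : H.IsAcyclic := hG.induce _
  have : Nonempty (U : Set V) := ⟨⟨a, ha⟩⟩
  -- A neighbour of an end of a longest path lies on the path, and acyclicity then makes it the
  -- vertex next to that end.
  obtain ⟨u, v, p, hp, hmax⟩ := Walk.exists_isPath_forall_isPath_length_le_length H
  have hlen : 1 ≤ p.length := by
    have hadj : H.Adj ⟨a, ha⟩ ⟨b, hb⟩ := hab
    have h := hmax _ _ _ (Path.singleton hadj).2
    simpa using h
  have hadj : H.Adj u p.snd := p.adj_snd (by
    rw [← Walk.length_eq_zero_iff.not]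
    omega)
  refine ⟨u, u.2, p.snd, p.snd.2, hadj, ?_⟩
  intro z hz huz
  have huz' : H.Adj u ⟨z, hz⟩ := huz
  have hmem : (⟨z, hz⟩ : (U : Set V)) ∈ p.support := by
    by_contra hnot
    have h := hmax _ _ _ (hp.cons (h := huz'.symm) hnot)
    simp at h
  exact congrArg Subtype.val (hHa.eq_snd_of_adj_start hp huz' hmem)

/-- In an acyclic graph with an edge inside `U`, some vertex `v` of `U` has at least one leaf
neighbour, and all its neighbours but possibly one, `w`, are leaves. If there is no exceptional
neighbour, then `w = v`. -/
theorem IsAcyclic.exists_support_in (hG : G.IsAcyclic) (U : Finset V) {a b : V} (ha : a ∈ U)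
    (hb : b ∈ U) (hab : G.Adj a b) :
    ∃ v ∈ U, ∃ w, (w = v ∨ G.Adj v w) ∧ (∃ l ∈ U, G.Adj v l ∧ l ≠ w) ∧
      ∀ x ∈ U, G.Adj v x → x ≠ w → ∀ y ∈ U, G.Adj x y → y = v := by
  classical
  let IsLeaf : V → Prop := fun x => ∃ y, ∀ z ∈ U, G.Adj x z → z = y
  have leaf_spec : ∀ {x v}, IsLeaf x → v ∈ U → G.Adj v x → ∀ y ∈ U, G.Adj x y → y = v := by
    rintro x v ⟨c, hc⟩ hv hvx y hy hxy
    rw [hc y hy hxy, hc v hv hvx.symm]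
  -- Prune all leaves. If an edge survives, a leaf `v` of the pruned graph works, with `w` its
  -- surviving neighbour; as `v` was not pruned, it has a further neighbour. If no edge survives,
  -- every non-leaf has only leaves as neighbours.
  by_cases hedge : ∃ c ∈ U, ∃ d ∈ U, G.Adj c d ∧ ¬ IsLeaf c ∧ ¬ IsLeaf d
  · obtain ⟨c, hc, d, hd, hcd, hcl, hdl⟩ := hedge
    obtain ⟨v, hv, w, hw, hvw, huniq⟩ := hG.exists_leaf_in (U.filter fun x => ¬ IsLeaf x)
      (Finset.mem_filter.mpr ⟨hc, hcl⟩) (Finset.mem_filter.mpr ⟨hd, hdl⟩) hcd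
    rw [Finset.mem_filter] at hv hw
    have hleaf : ∀ x ∈ U, G.Adj v x → x ≠ w → IsLeaf x := by
      intro x hx hvx hxw
      by_contra hxl
      exact hxw (huniq x (Finset.mem_filter.mpr ⟨hx, hxl⟩) hvx)
    refine ⟨v, hv.1, w, Or.inr hvw, ?_, fun x hx hvx hxw =>
      leaf_spec (hleaf x hx hvx hxw) hv.1 hvx⟩
    by_contra! hno
    exact hv.2 ⟨w, hno⟩
  · push Not at hedge
    by_cases hal : IsLeaf a
    · by_cases hbl : IsLeaf b
      · refine ⟨a, ha, a, Or.inl rfl, ⟨b, hb, hab, hab.ne'⟩, ?_⟩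
        intro x hx hax _
        rw [leaf_spec hal hb hab.symm x hx hax]
        exact leaf_spec hbl ha hab
      · refine ⟨b, hb, b, Or.inl rfl, ⟨a, ha, hab.symm, hab.ne⟩, ?_⟩
        intro x hx hbx _
        exact leaf_spec (hedge b hb x hx hbx hbl) hb hbx
    · refine ⟨a, ha, a, Or.inl rfl, ⟨b, hb, hab, hab.ne'⟩, ?_⟩
      intro x hx hax _
      exact leaf_spec (hedge a ha x hx hax hal) ha hax

end SimpleGraph

/-! ### Splitting the dominating sets into columns -/

namespace SimpleGraph

variable {V : Type*} [DecidableEq V] {G : SimpleGraph V}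

/-- The adjacency relation of the TARS-graph, on all finite sets of vertices. -/
def TarsRel (G : SimpleGraph V) (X Y : Finset V) : Prop :=
  TokenAddRemove X Y ∨ G.TokenSlide X Y

theorem TarsRel.symm {X Y : Finset V} (h : G.TarsRel X Y) : G.TarsRel Y X :=
  h.imp TokenAddRemove.symm TokenSlide.symm

/-- Untouched extra tokens do not affect a move. This turns moves in the core into links between
columns. -/
theorem TarsRel.union {X Y J : Finset V} (h : G.TarsRel X Y) (hX : Disjoint X J)
    (hY : Disjoint Y J) : G.TarsRel (X ∪ J) (Y ∪ J) := by
  rw [Finset.disjoint_left] at hX hY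
  rcases h with (⟨u, hu, rfl⟩ | ⟨u, hu, rfl⟩) | ⟨u, v, hu, hv, huv, rfl⟩
  · refine Or.inl (Or.inl ⟨u, ?_, ?_⟩)
    · have := hY (Finset.mem_insert_self u X)
      simp [hu, this]
    · simp
  · refine Or.inl (Or.inr ⟨u, by simp [hu], ?_⟩)
    ext x
    simp only [Finset.mem_union, Finset.mem_erase]
    grind
  · have hvJ := hY (Finset.mem_sdiff.mp hv).1
    refine Or.inr ⟨u, v, by simp [hu], ?_, huv, ?_⟩
    · simp only [Finset.mem_sdiff, Finset.mem_union] at hv ⊢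
      grind
    · ext x
      simp only [Finset.mem_union, Finset.mem_erase, Finset.mem_insert]
      grind

/-- `S` is a dominating set of the subgraph of `G` induced by `U`. -/
def DominatesIn (G : SimpleGraph V) (U S : Finset V) : Prop :=
  S ⊆ U ∧ ∀ x ∈ U, x ∉ S → ∃ u ∈ S, G.Adj u x

/-- `v` is a vertex of `U` with a leaf neighbour, and all its neighbours in `U` but possibly `w`
are leaves of the subgraph induced by `U`. -/
structure IsSupport (G : SimpleGraph V) (U : Finset V) (v w : V) : Prop where
  mem : v ∈ U
  eq_or_adj : w = v ∨ G.Adj v w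
  exists_leaf : ∃ l ∈ U, G.Adj v l ∧ l ≠ w
  leaf : ∀ x ∈ U, G.Adj v x → x ≠ w → ∀ y ∈ U, G.Adj x y → y = v

open Classical in
/-- The leaves at `v`. -/
noncomputable def leaves (G : SimpleGraph V) (U : Finset V) (v w : V) : Finset V :=
  U.filter fun x => G.Adj v x ∧ x ≠ w

/-- What remains of `U` without `v` and the leaves at `v`. -/
noncomputable def core (G : SimpleGraph V) (U : Finset V) (v w : V) : Finset V :=
  U \ insert v (G.leaves U v w)

/-- `P` dominates all vertices of the core, except possibly `w`. -/
def AlmostDominates (G : SimpleGraph V) (U : Finset V) (v w : V) (P : Finset V) : Prop :=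
  P ⊆ G.core U v w ∧ ∀ x ∈ G.core U v w, x ≠ w → x ∉ P → ∃ u ∈ P, G.Adj u x

open Classical in
/-- The coordinates of the cube above a dominating set `Q` of the core. -/
noncomputable def coords (G : SimpleGraph V) (U : Finset V) (v w : V) (Q : Finset V) : Finset V :=
  if w ∈ Q ∧ ¬ G.DominatesIn (G.core U v w) (Q.erase w) ∧ G.AlmostDominates U v w (Q.erase w)
  then insert w (G.leaves U v w) else G.leaves U v w

/-- The vertex of the cube above `Q` with given coordinates. -/
noncomputable def cubeMap (G : SimpleGraph V) (U : Finset V) (v w : V) (Q X : Finset V) :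
    Finset V :=
  insert v ((Q \ G.coords U v w Q) ∪ X)

open Classical in
/-- The dominating set of the core to whose column `S` belongs. -/
noncomputable def columnIndex (G : SimpleGraph V) (U : Finset V) (v w : V) (S : Finset V) :
    Finset V :=
  if G.DominatesIn (G.core U v w) (S ∩ G.core U v w) then S ∩ G.core U v w
  else insert w (S ∩ G.core U v w)

namespace IsSupport

variable {U : Finset V} {v w : V} {Q X : Finset V}

theorem mem_leaves {x : V} : x ∈ G.leaves U v w ↔ x ∈ U ∧ G.Adj v x ∧ x ≠ w := by
  simp [leaves]

theorem mem_core {x : V} : x ∈ G.core U v w ↔ x ∈ U ∧ x ≠ v ∧ x ∉ G.leaves U v w := by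
  simp [core]

theorem notMem_leaves : v ∉ G.leaves U v w := by
  simp [mem_leaves]

theorem notMem_core : v ∉ G.core U v w := by
  simp [mem_core]

theorem eq_of_adj_of_mem_core {x : V} (hx : x ∈ G.core U v w) (hvx : G.Adj v x) : x = w := by
  rw [mem_core, mem_leaves] at hx
  by_contra h
  exact hx.2.2 ⟨hx.1, hvx, h⟩

theorem mem_cases {x : V} (hx : x ∈ U) : x = v ∨ x ∈ G.leaves U v w ∨ x ∈ G.core U v w := by
  rw [mem_core]
  tauto

theorem almost_of_dominates (hQ : G.DominatesIn (G.core U v w) Q) :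
    G.AlmostDominates U v w Q :=
  ⟨hQ.1, fun x hx _ => hQ.2 x hx⟩

theorem disjoint_leaves (hQ : Q ⊆ G.core U v w) : Disjoint Q (G.leaves U v w) := by
  rw [Finset.disjoint_left]
  intro x hx
  exact (mem_core.mp (hQ hx)).2.2

theorem notMem_of_subset_core (hQ : Q ⊆ G.core U v w) : v ∉ Q := fun h => notMem_core (hQ h)

/-- In the second case `w` is a free coordinate: `Q.erase w` indexes no column of its own, and `v`
can dominate `w` in its place. -/
theorem coords_cases (hQ : Q ⊆ G.core U v w) :
    (G.coords U v w Q = G.leaves U v w ∧ Q \ G.coords U v w Q = Q) ∨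
    (G.coords U v w Q = insert w (G.leaves U v w) ∧ Q \ G.coords U v w Q = Q.erase w ∧ w ∈ Q ∧
      ¬ G.DominatesIn (G.core U v w) (Q.erase w) ∧ G.AlmostDominates U v w (Q.erase w)) := by
  have hdisj := disjoint_leaves hQ
  by_cases h : w ∈ Q ∧ ¬ G.DominatesIn (G.core U v w) (Q.erase w) ∧
      G.AlmostDominates U v w (Q.erase w)
  · right
    have hc : G.coords U v w Q = insert w (G.leaves U v w) := if_pos h
    refine ⟨hc, ?_, h⟩
    rw [hc, Finset.sdiff_insert, Finset.sdiff_eq_self_of_disjoint hdisj]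
  · left
    have hc : G.coords U v w Q = G.leaves U v w := if_neg h
    exact ⟨hc, by rw [hc, Finset.sdiff_eq_self_of_disjoint hdisj]⟩

theorem leaves_subset_coords (hQ : Q ⊆ G.core U v w) :
    G.leaves U v w ⊆ G.coords U v w Q := by
  rcases coords_cases hQ with ⟨h, -⟩ | ⟨h, -⟩ <;> rw [h]
  exact Finset.subset_insert _ _

theorem mem_coords {a : V} (hQ : Q ⊆ G.core U v w) (ha : a ∈ G.coords U v w Q) :
    a ∈ G.leaves U v w ∨ (a = w ∧ a ∈ Q) := by
  rcases coords_cases hQ with ⟨h, -⟩ | ⟨h, -, hw, -⟩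
  · exact Or.inl (h ▸ ha)
  · rw [h, Finset.mem_insert] at ha
    rcases ha with rfl | ha
    · exact Or.inr ⟨rfl, hw⟩
    · exact Or.inl ha

theorem notMem_coords (hQ : Q ⊆ G.core U v w) : v ∉ G.coords U v w Q := by
  intro h
  rcases mem_coords hQ h with h | h
  · exact notMem_leaves h
  · exact notMem_core (hQ h.2)

theorem coords_subset (hQ : Q ⊆ G.core U v w) : G.coords U v w Q ⊆ Q ∪ G.leaves U v w := by
  intro a ha
  rcases mem_coords hQ ha with h | h
  · exact Finset.mem_union_right _ h
  · exact Finset.mem_union_left _ h.2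

theorem cubeMap_coords (hQ : Q ⊆ G.core U v w) :
    G.cubeMap U v w Q (G.coords U v w Q) = insert v (Q ∪ G.leaves U v w) := by
  have h1 := coords_subset hQ
  have h2 := leaves_subset_coords hQ
  ext x
  have h1 := @h1 x
  have h2 := @h2 x
  simp only [cubeMap, Finset.mem_insert, Finset.mem_union, Finset.mem_sdiff] at *
  tauto

theorem cubeMap_coords_erase (hQ : Q ⊆ G.core U v w) {a : V} (ha : a ∈ G.coords U v w Q) :
    G.cubeMap U v w Q ((G.coords U v w Q).erase a) =
      (insert v (Q ∪ G.leaves U v w)).erase a := by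
  rw [← cubeMap_coords hQ]
  have hv : v ≠ a := by
    rintro rfl
    exact notMem_coords hQ ha
  ext x
  simp only [cubeMap, Finset.mem_insert, Finset.mem_union, Finset.mem_sdiff, Finset.mem_erase]
  grind

theorem adj_of_mem_coords (h : G.IsSupport U v w) (hQ : Q ⊆ G.core U v w) {a : V}
    (ha : a ∈ G.coords U v w Q) : G.Adj v a := by
  rcases mem_coords hQ ha with hal | ⟨rfl, haQ⟩
  · exact (mem_leaves.mp hal).2.1
  · exact h.eq_or_adj.resolve_left (mem_core.mp (hQ haQ)).2.1

/-- The token on `a` slides to `v`. This includes `a = w`, since a `w` in the core is a neighbour of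
`v`. -/
theorem tarsRel_coatom (h : G.IsSupport U v w) (hQ : Q ⊆ G.core U v w) {a : V}
    (ha : a ∈ G.coords U v w Q) :
    G.TarsRel (Q ∪ G.leaves U v w) (G.cubeMap U v w Q ((G.coords U v w Q).erase a)) := by
  have hva := h.adj_of_mem_coords hQ ha
  rw [cubeMap_coords_erase hQ ha]
  refine Or.inr ⟨a, v, coords_subset hQ ha, ?_, hva.symm, rfl⟩
  simp [hva.ne, notMem_leaves, notMem_of_subset_core hQ]

theorem tarsRel_top (hQ : Q ⊆ G.core U v w) :
    G.TarsRel (Q ∪ G.leaves U v w) (insert v (Q ∪ G.leaves U v w)) :=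
  Or.inl (Or.inl ⟨v, by simp [notMem_leaves, notMem_of_subset_core hQ], rfl⟩)

theorem cubeMap_injOn (hQ : Q ⊆ G.core U v w) :
    Set.InjOn (G.cubeMap U v w Q) {X | X ⊆ G.coords U v w Q} := by
  have hv := notMem_coords hQ
  intro X hX Y hY hXY
  ext x
  have hx : x ∈ G.cubeMap U v w Q X ↔ x ∈ G.cubeMap U v w Q Y := by rw [hXY]
  simp only [cubeMap, Finset.mem_insert, Finset.mem_union, Finset.mem_sdiff] at hx
  have h1 := @hX x
  have h2 := @hY x
  grind

theorem cubeMap_addRemove (hQ : Q ⊆ G.core U v w) {X Y : Finset V}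
    (hX : X ⊆ G.coords U v w Q) (hY : Y ⊆ G.coords U v w Q) (h : TokenAddRemove X Y) :
    TokenAddRemove (G.cubeMap U v w Q X) (G.cubeMap U v w Q Y) := by
  have hv := notMem_coords hQ
  rcases h with ⟨u, hu, rfl⟩ | ⟨u, hu, rfl⟩
  · have huc := hY (Finset.mem_insert_self u X)
    have huv : u ≠ v := fun h => hv (h ▸ huc)
    refine Or.inl ⟨u, by simp [cubeMap, huv, huc, hu], ?_⟩
    ext x
    simp only [cubeMap, Finset.mem_insert, Finset.mem_union]
    tauto
  · have huc := hX hu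
    have huv : u ≠ v := fun h => hv (h ▸ huc)
    refine Or.inr ⟨u, by simp [cubeMap, hu], ?_⟩
    ext x
    simp only [cubeMap, Finset.mem_insert, Finset.mem_union, Finset.mem_erase, Finset.mem_sdiff]
    grind

theorem not_adj_of_mem_leaves (h : G.IsSupport U v w) {u x : V} (hu : u ∈ G.leaves U v w)
    (hx : x ∈ G.core U v w) : ¬ G.Adj u x := by
  rw [mem_leaves] at hu
  intro hux
  exact (mem_core.mp hx).2.1 (h.leaf u hu.1 hu.2.1 hu.2.2 x (mem_core.mp hx).1 hux)

theorem core_subset : G.core U v w ⊆ U := Finset.sdiff_subset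

theorem dominates_union_leaves (h : G.IsSupport U v w)
    (hQ : G.DominatesIn (G.core U v w) Q) : G.DominatesIn U (Q ∪ G.leaves U v w) := by
  refine ⟨Finset.union_subset (hQ.1.trans core_subset) fun x hx => (mem_leaves.mp hx).1, ?_⟩
  intro x hx hxS
  rw [Finset.mem_union, not_or] at hxS
  rcases mem_cases (G := G) (v := v) (w := w) hx with rfl | hxl | hxc
  · obtain ⟨l, hl, hvl, hlw⟩ := h.exists_leaf
    exact ⟨l, Finset.mem_union_right _ (mem_leaves.mpr ⟨hl, hvl, hlw⟩), hvl.symm⟩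
  · exact absurd hxl hxS.2
  · obtain ⟨u, hu, hux⟩ := hQ.2 x hxc hxS.1
    exact ⟨u, Finset.mem_union_left _ hu, hux⟩

/-- The vertex `v` takes care of its leaves and of `w`, and `P` of the rest of the core. -/
theorem dominates_insert (h : G.IsSupport U v w) {P : Finset V}
    (hP : G.AlmostDominates U v w P) (hX : X ⊆ U) : G.DominatesIn U (insert v (P ∪ X)) := by
  refine ⟨Finset.insert_subset h.mem (Finset.union_subset (hP.1.trans core_subset) hX), ?_⟩
  intro x hx hxS
  simp only [Finset.mem_insert, Finset.mem_union, not_or] at hxS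
  have hv : v ∈ insert v (P ∪ X) := Finset.mem_insert_self _ _
  rcases mem_cases (G := G) (v := v) (w := w) hx with rfl | hxl | hxc
  · exact absurd rfl hxS.1
  · exact ⟨v, hv, (mem_leaves.mp hxl).2.1⟩
  · by_cases hxw : x = w
    · subst hxw
      exact ⟨v, hv, h.eq_or_adj.resolve_left hxS.1⟩
    · obtain ⟨u, hu, hux⟩ := hP.2 x hxc hxw hxS.2.1
      exact ⟨u, Finset.mem_insert_of_mem (Finset.mem_union_left _ hu), hux⟩

theorem dominates_cubeMap (h : G.IsSupport U v w) (hQ : G.DominatesIn (G.core U v w) Q)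
    (hX : X ⊆ G.coords U v w Q) : G.DominatesIn U (G.cubeMap U v w Q X) := by
  have hXU : X ⊆ U := hX.trans ((coords_subset hQ.1).trans (h.dominates_union_leaves hQ).1)
  rw [cubeMap]
  rcases coords_cases hQ.1 with ⟨-, h2⟩ | ⟨-, h2, -, -, h5⟩
  · rw [h2]
    exact h.dominates_insert (almost_of_dominates hQ) hXU
  · rw [h2]
    exact h.dominates_insert h5 hXU

theorem columnIndex_union_leaves (hQ : G.DominatesIn (G.core U v w) Q) :
    G.columnIndex U v w (Q ∪ G.leaves U v w) = Q := by
  have hcore : (Q ∪ G.leaves U v w) ∩ G.core U v w = Q := by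
    ext x
    have hx := @hQ.1 x
    simp only [Finset.mem_inter, Finset.mem_union, mem_core] at hx ⊢
    tauto
  rw [columnIndex, hcore, if_pos hQ]

/-- If `w` has been dropped, the trace on the core is the non-dominating set `Q.erase w`, and the
index restores `w`. Recovering `Q` in this way makes the columns disjoint. -/
theorem columnIndex_cubeMap (hQ : G.DominatesIn (G.core U v w) Q)
    (hX : X ⊆ G.coords U v w Q) : G.columnIndex U v w (G.cubeMap U v w Q X) = Q := by
  rcases coords_cases hQ.1 with ⟨h1, h2⟩ | ⟨h1, h2, h3, h4, -⟩
  · have hcore : G.cubeMap U v w Q X ∩ G.core U v w = Q := by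
      rw [cubeMap, h2]
      rw [h1] at hX
      ext x
      have hx := @hQ.1 x
      have hx' := @hX x
      simp only [Finset.mem_inter, Finset.mem_insert, Finset.mem_union, mem_core] at hx hx' ⊢
      tauto
    rw [columnIndex, hcore, if_pos hQ]
  · by_cases hw : w ∈ X
    · have hcore : G.cubeMap U v w Q X ∩ G.core U v w = Q := by
        rw [cubeMap, h2]
        rw [h1] at hX
        ext x
        have hx := @hQ.1 x
        have hx' := @hX x
        simp only [Finset.mem_inter, Finset.mem_insert, Finset.mem_union, mem_core,
          Finset.mem_erase] at hx hx' ⊢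
        grind
      rw [columnIndex, hcore, if_pos hQ]
    · have hcore : G.cubeMap U v w Q X ∩ G.core U v w = Q.erase w := by
        rw [cubeMap, h2]
        rw [h1] at hX
        ext x
        have hx := @hQ.1 x
        have hx' := @hX x
        simp only [Finset.mem_inter, Finset.mem_insert, Finset.mem_union, mem_core,
          Finset.mem_erase] at hx hx' ⊢
        grind
      rw [columnIndex, hcore, if_neg h4, Finset.insert_erase h3]

/-- Every dominating set lies in a column. -/
theorem exists_column (h : G.IsSupport U v w) {S : Finset V} (hS : G.DominatesIn U S) :
    ∃ Q, G.DominatesIn (G.core U v w) Q ∧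
      (S = Q ∪ G.leaves U v w ∨ ∃ X ⊆ G.coords U v w Q, S = G.cubeMap U v w Q X) := by
  have hcore : ∀ x ∈ G.core U v w, x ∉ S → (v ∈ S → x ≠ w) →
      ∃ u ∈ S ∩ G.core U v w, G.Adj u x := by
    intro x hx hxS hxw
    obtain ⟨u, hu, hux⟩ := hS.2 x (core_subset hx) hxS
    rcases mem_cases (G := G) (v := v) (w := w) (hS.1 hu) with rfl | hul | huc
    · exact absurd (eq_of_adj_of_mem_core hx hux) (hxw hu)
    · exact absurd hux (h.not_adj_of_mem_leaves hul hx)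
    · exact ⟨u, Finset.mem_inter.mpr ⟨hu, huc⟩, hux⟩
  by_cases hv : v ∈ S
  · have halmost : G.AlmostDominates U v w (S ∩ G.core U v w) :=
      ⟨Finset.inter_subset_right, fun x hx hxw hxS =>
        hcore x hx (fun h => hxS (Finset.mem_inter.mpr ⟨h, hx⟩)) fun _ => hxw⟩
    obtain ⟨Q, hQ, hQS, hQ'⟩ : ∃ Q, G.DominatesIn (G.core U v w) Q ∧
        S ∩ G.core U v w ⊆ Q ∧ Q \ G.coords U v w Q ⊆ S := by
      by_cases hdom : G.DominatesIn (G.core U v w) (S ∩ G.core U v w)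
      · exact ⟨_, hdom, Finset.Subset.refl _,
          Finset.sdiff_subset.trans Finset.inter_subset_left⟩
      -- The trace dominates everything in the core but possibly `w`, so `w` is the vertex at which
      -- it fails.
      · have hw : w ∈ G.core U v w ∧ w ∉ S := by
          by_contra hw
          refine hdom ⟨halmost.1, fun x hx hxS => halmost.2 x hx ?_ hxS⟩
          rintro rfl
          exact hw ⟨hx, fun h => hxS (Finset.mem_inter.mpr ⟨h, hx⟩)⟩
        have hwS : w ∉ S ∩ G.core U v w := fun h => hw.2 (Finset.mem_inter.mp h).1
        have hQ : G.DominatesIn (G.core U v w) (insert w (S ∩ G.core U v w)) := by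
          refine ⟨Finset.insert_subset hw.1 halmost.1, ?_⟩
          intro x hx hxS
          rw [Finset.mem_insert, not_or] at hxS
          obtain ⟨u, hu, hux⟩ := halmost.2 x hx hxS.1 hxS.2
          exact ⟨u, Finset.mem_insert_of_mem hu, hux⟩
        refine ⟨_, hQ, Finset.subset_insert _ _, ?_⟩
        have hc : G.coords U v w (insert w (S ∩ G.core U v w)) =
            insert w (G.leaves U v w) := by
          refine if_pos ⟨Finset.mem_insert_self _ _, ?_⟩
          rw [Finset.erase_insert hwS]
          exact ⟨hdom, halmost⟩
        rw [hc]
        intro x hx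
        simp only [Finset.mem_sdiff, Finset.mem_insert, Finset.mem_inter] at hx
        tauto
    refine ⟨Q, hQ, Or.inr ⟨S ∩ G.coords U v w Q, Finset.inter_subset_right, ?_⟩⟩
    have hl := leaves_subset_coords hQ.1
    ext x
    have h1 := @hQS x
    have h2 := @hQ' x
    have h3 := @hl x
    have h4 := @hS.1 x
    have h5 := fun hx => mem_cases (G := G) (U := U) (v := v) (w := w) (x := x) hx
    simp only [cubeMap, Finset.mem_insert, Finset.mem_union, Finset.mem_inter,
      Finset.mem_sdiff] at h1 h2 ⊢
    grind
  -- A leaf outside `S` could only be dominated by `v`.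
  · have hleaves : G.leaves U v w ⊆ S := by
      intro l hl
      by_contra hlS
      obtain ⟨hlU, hvl, hlw⟩ := mem_leaves.mp hl
      obtain ⟨u, hu, hul⟩ := hS.2 l hlU hlS
      exact hv (h.leaf l hlU hvl hlw u (hS.1 hu) hul.symm ▸ hu)
    refine ⟨S ∩ G.core U v w, ⟨Finset.inter_subset_right, fun x hx hxS => hcore x hx
      (fun h => hxS (Finset.mem_inter.mpr ⟨h, hx⟩)) fun h => absurd h hv⟩, Or.inl ?_⟩
    ext x
    have h1 := @hleaves x
    have h2 := @hS.1 x
    have h3 := fun hx => mem_cases (G := G) (U := U) (v := v) (w := w) (x := x) hx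
    simp only [Finset.mem_union, Finset.mem_inter]
    grind

end IsSupport

end SimpleGraph

/-! ### The columns as a column system -/

namespace SimpleGraph

variable {V : Type*} [DecidableEq V] {G : SimpleGraph V}

namespace IsSupport

variable {U : Finset V} {v w : V}

theorem disjoint_insert_leaves {Q : Finset V} (hQ : Q ⊆ G.core U v w) :
    Disjoint Q (insert v (G.leaves U v w)) := by
  rw [Finset.disjoint_insert_right]
  exact ⟨notMem_of_subset_core hQ, disjoint_leaves hQ⟩

theorem cubeMap_erase_leaf {Q : Finset V} (hQ : Q ⊆ G.core U v w) {l : V}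
    (hl : l ∈ G.leaves U v w) : G.cubeMap U v w Q ((G.coords U v w Q).erase l) =
      Q ∪ (insert v (G.leaves U v w)).erase l := by
  have hlQ : l ∉ Q := fun h => Finset.disjoint_left.mp (disjoint_leaves hQ) h hl
  rw [cubeMap_coords_erase hQ (leaves_subset_coords hQ hl), ← Finset.union_insert,
    Finset.erase_union_distrib, Finset.erase_eq_of_notMem hlQ]

theorem path_cubeMap {Q X Y : Finset V} (hQ : Q ⊆ G.core U v w) {n : ℕ}
    (h : HasPath TokenAddRemove {X | X ⊆ G.coords U v w Q} X Y n) :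
    HasPath G.TarsRel (G.cubeMap U v w Q '' {X | X ⊆ G.coords U v w Q})
      (G.cubeMap U v w Q X) (G.cubeMap U v w Q Y) n :=
  h.map _ (cubeMap_injOn hQ) fun _ hX _ hY hXY => Or.inl (cubeMap_addRemove hQ hX hY hXY)

theorem path_top_coatom {Q : Finset V} (hQ : Q ⊆ G.core U v w) {l : V}
    (hl : l ∈ G.leaves U v w) {n : ℕ} (hn : Even n) (hn2 : 2 ≤ n)
    (hnN : n ≤ 2 ^ (G.coords U v w Q).card) :
    HasPath G.TarsRel (G.cubeMap U v w Q '' {X | X ⊆ G.coords U v w Q})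
      (Q ∪ insert v (G.leaves U v w)) (Q ∪ (insert v (G.leaves U v w)).erase l) n := by
  rw [← cubeMap_erase_leaf hQ hl, Finset.union_insert, ← cubeMap_coords hQ]
  exact path_cubeMap hQ (hasPath_powerset _ _ rfl l (leaves_subset_coords hQ hl) n hn hn2 hnN)

/-- The columns of dominating sets of the subgraph induced by `U`, indexed by the dominating sets
of the core. -/
noncomputable def columnSystem (h : G.IsSupport U v w) {l : V} (hl : l ∈ G.leaves U v w) :
    ColumnSystem G.TarsRel G.TarsRel {Q | G.DominatesIn (G.core U v w) Q} where
  z Q := Q ∪ G.leaves U v w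
  t Q := Q ∪ insert v (G.leaves U v w)
  b Q := Q ∪ (insert v (G.leaves U v w)).erase l
  K Q := G.cubeMap U v w Q '' {X | X ⊆ G.coords U v w Q}
  N Q := 2 ^ (G.coords U v w Q).card
  symm _ _ := TarsRel.symm
  even_N Q hQ := Nat.even_pow.mpr
    ⟨even_two, Finset.card_ne_zero_of_mem (leaves_subset_coords hQ.1 hl)⟩
  two_le_N Q hQ := Nat.le_self_pow (Finset.card_ne_zero_of_mem (leaves_subset_coords hQ.1 hl)) 2
  z_notMem := by
    rintro Q hQ ⟨X, -, hX⟩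
    have hv : v ∈ Q ∪ G.leaves U v w := hX ▸ Finset.mem_insert_self _ _
    simp [notMem_leaves, notMem_of_subset_core hQ.1] at hv
  pairwise_disjoint := by
    have hcol : ∀ Q, G.DominatesIn (G.core U v w) Q → ∀ S ∈ insert (Q ∪ G.leaves U v w)
        (G.cubeMap U v w Q '' {X | X ⊆ G.coords U v w Q}), G.columnIndex U v w S = Q := by
      rintro Q hQ S (rfl | ⟨X, hX, rfl⟩)
      · exact columnIndex_union_leaves hQ
      · exact columnIndex_cubeMap hQ hX
    intro Q hQ Q' hQ' hne
    rw [Set.disjoint_left]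
    intro S hS hS'
    exact hne ((hcol Q hQ S hS).symm.trans (hcol Q' hQ' S hS'))
  z_adj_t Q hQ := by
    rw [Finset.union_insert]
    exact tarsRel_top hQ.1
  z_adj_b Q hQ := by
    rw [← cubeMap_erase_leaf hQ.1 hl]
    exact h.tarsRel_coatom hQ.1 (leaves_subset_coords hQ.1 hl)
  adj_z Q hQ Q' hQ' hQQ' := hQQ'.union (disjoint_leaves hQ.1) (disjoint_leaves hQ'.1)
  adj_t Q hQ Q' hQ' hQQ' := hQQ'.union (disjoint_insert_leaves hQ.1)
    (disjoint_insert_leaves hQ'.1)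
  -- The same leaf `l` is missing in every column, so the sets `b` differ only in the core.
  adj_b Q hQ Q' hQ' hQQ' := hQQ'.union
    ((disjoint_insert_leaves hQ.1).mono_right (Finset.erase_subset _ _))
    ((disjoint_insert_leaves hQ'.1).mono_right (Finset.erase_subset _ _))
  path_t_b Q hQ n hn hn2 hnN := path_top_coatom hQ.1 hl hn hn2 hnN
  path_to_b Q hQ n hn hnN := by
    have hlc := leaves_subset_coords hQ.1 hl
    rcases Nat.even_or_odd n with he | ho
    · refine ⟨_, ?_, path_top_coatom hQ.1 hl he ?_ hnN⟩
      · rw [Finset.union_insert]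
        exact tarsRel_top hQ.1
      · obtain ⟨c, rfl⟩ := he
        omega
    · obtain ⟨c, rfl⟩ := ho
      have hN : Even (2 ^ (G.coords U v w Q).card) := Nat.even_pow.mpr
        ⟨even_two, Finset.card_ne_zero_of_mem hlc⟩
      -- Odd order: take one vertex more, which fits because the cube has even order, and drop the
      -- top. The new start is some coatom, hence a neighbour of `z`.
      have hpath := hasPath_powerset _ _ rfl l hlc (2 * c + 2) ⟨c + 1, by ring⟩ (by omega)
        (by obtain ⟨e, he⟩ := hN; omega)
      obtain ⟨X, hX, hXpath⟩ := hpath.uncons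
      have hXc : X ⊆ G.coords U v w Q := hXpath.left_mem.1
      obtain ⟨a, ha, rfl⟩ : ∃ a ∈ G.coords U v w Q, X = (G.coords U v w Q).erase a := by
        rcases hX with ⟨u, hu, rfl⟩ | ⟨u, hu, rfl⟩
        · exact absurd (hXc (Finset.mem_insert_self _ _)) hu
        · exact ⟨u, hu, rfl⟩
      refine ⟨_, h.tarsRel_coatom hQ.1 ha, ?_⟩
      rw [← cubeMap_erase_leaf hQ.1 hl]
      exact path_cubeMap hQ.1 (hXpath.mono Set.sdiff_subset)

end IsSupport

/-! ### Hamiltonian paths and pancyclicity -/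

open Classical in
/-- The dominating sets of the subgraph induced by `U`. -/
noncomputable def dominatingSets (G : SimpleGraph V) (U : Finset V) : Finset (Finset V) :=
  U.powerset.filter (G.DominatesIn U)

theorem mem_dominatingSets {V : Type*} {G : SimpleGraph V} {U S : Finset V} :
    S ∈ G.dominatingSets U ↔ G.DominatesIn U S := by
  simp only [dominatingSets, Finset.mem_filter, Finset.mem_powerset, and_iff_right_iff_imp]
  exact fun h => h.1

theorem dominatesIn_self {V : Type*} (G : SimpleGraph V) (U : Finset V) : G.DominatesIn U U :=
  ⟨Finset.Subset.refl _, fun _ hx hxU => absurd hx hxU⟩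

namespace IsSupport

variable {U : Finset V} {v w : V}

/-- The columns cover all dominating sets. This bound suffices: a path on as many distinct
dominating sets as the total size must contain them all. -/
theorem card_dominatingSets_le (h : G.IsSupport U v w) {l : V} (hl : l ∈ G.leaves U v w)
    {Qs : List (Finset V)} (hnd : Qs.Nodup) (hmem : ∀ Q, Q ∈ Qs ↔ G.DominatesIn (G.core U v w) Q) :
    (G.dominatingSets U).card ≤ (h.columnSystem hl).size Qs := by
  have hsub : G.dominatingSets U ⊆ Qs.toFinset.biUnion fun Q =>
      insert (Q ∪ G.leaves U v w) ((G.coords U v w Q).powerset.image (G.cubeMap U v w Q)) := by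
    intro S hS
    obtain ⟨Q, hQ, hSQ⟩ := h.exists_column (mem_dominatingSets.mp hS)
    rw [Finset.mem_biUnion]
    refine ⟨Q, by simpa using (hmem Q).mpr hQ, ?_⟩
    rw [Finset.mem_insert, Finset.mem_image]
    rcases hSQ with hSQ | ⟨X, hX, rfl⟩
    · exact Or.inl hSQ
    · exact Or.inr ⟨X, Finset.mem_powerset.mpr hX, rfl⟩
  refine (Finset.card_le_card hsub).trans (Finset.card_biUnion_le.trans ?_)
  rw [ColumnSystem.size, ← List.sum_toFinset _ hnd]
  refine Finset.sum_le_sum fun Q _ => (Finset.card_insert_le _ _).trans ?_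
  have := (Finset.card_image_le (s := (G.coords U v w Q).powerset) (f := G.cubeMap U v w Q))
  rw [Finset.card_powerset] at this
  exact Nat.add_le_add_right this 1

theorem exists_cycle (h : G.IsSupport U v w) {l : V} (hl : l ∈ G.leaves U v w)
    {Qs : List (Finset V)} (hnd : Qs.Nodup) (hch : Qs.IsChain G.TarsRel)
    (hmem : ∀ Q, Q ∈ Qs ↔ G.DominatesIn (G.core U v w) Q) {n : ℕ} (hn : 3 ≤ n)
    (hnN : n ≤ (h.columnSystem hl).size Qs) :
    ∃ X Y, G.TarsRel Y X ∧ HasPath G.TarsRel {S | G.DominatesIn U S} X Y n := by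
  have hne : Qs ≠ [] := List.ne_nil_of_mem ((hmem _).mpr (G.dominatesIn_self _))
  obtain ⟨X, Y, hYX, hpath⟩ := (h.columnSystem hl).exists_cycle Qs hne
    (fun Q hQ => (hmem Q).mp hQ) hnd hch n hn hnN
  refine ⟨X, Y, hYX, hpath.mono ?_⟩
  rintro S ⟨Q, hQ, rfl | ⟨X, hX, rfl⟩⟩
  · exact h.dominates_union_leaves ((hmem Q).mp hQ)
  · exact h.dominates_cubeMap ((hmem Q).mp hQ) hX

theorem three_le_size (h : G.IsSupport U v w) {l : V} (hl : l ∈ G.leaves U v w)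
    {Qs : List (Finset V)} (hmem : ∀ Q, Q ∈ Qs ↔ G.DominatesIn (G.core U v w) Q) :
    3 ≤ (h.columnSystem hl).size Qs := by
  have hcore := G.dominatesIn_self (G.core U v w)
  have h1 := (h.columnSystem hl).two_le_N _ hcore
  have h2 := List.single_le_sum (l := Qs.map fun Q => (h.columnSystem hl).N Q + 1) (by simp) _
    (List.mem_map_of_mem ((hmem _).mpr hcore))
  exact le_trans (by omega) h2

end IsSupport

/-- The dominating sets of the subgraph of an acyclic graph induced by `U` have a Hamiltonian
path. -/
theorem IsAcyclic.exists_hamiltonian_path (hG : G.IsAcyclic) (U : Finset V) :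
    ∃ Qs : List (Finset V), Qs.Nodup ∧ Qs.IsChain G.TarsRel ∧
      ∀ S, S ∈ Qs ↔ G.DominatesIn U S := by
  induction U using Finset.strongInduction with
  | H U ih =>
    by_cases hedge : ∃ a ∈ U, ∃ b ∈ U, G.Adj a b
    · obtain ⟨a, ha, b, hb, hab⟩ := hedge
      obtain ⟨v, hv, w, h1, ⟨l, hlU, hvl, hlw⟩, h3⟩ := hG.exists_support_in U ha hb hab
      have h : G.IsSupport U v w := ⟨hv, h1, ⟨l, hlU, hvl, hlw⟩, h3⟩
      have hl : l ∈ G.leaves U v w := IsSupport.mem_leaves.mpr ⟨hlU, hvl, hlw⟩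
      obtain ⟨Qs, hnd, hch, hmem⟩ := ih (G.core U v w)
        ⟨IsSupport.core_subset, fun hsub => IsSupport.notMem_core (hsub hv)⟩
      obtain ⟨X, Y, -, Ss, h1, h2, -, -, h5, h6⟩ :=
        h.exists_cycle hl hnd hch hmem (h.three_le_size hl hmem) le_rfl
      refine ⟨Ss, h2, h1, fun S => ⟨h6 S, fun hS => ?_⟩⟩
      have hsub : Ss.toFinset ⊆ G.dominatingSets U := fun S hS =>
        mem_dominatingSets.mpr (h6 S (List.mem_toFinset.mp hS))
      have heq := Finset.eq_of_subset_of_card_le hsub (by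
        rw [List.toFinset_card_of_nodup h2, h5]
        exact h.card_dominatingSets_le hl hnd hmem)
      rw [← List.mem_toFinset, heq]
      exact mem_dominatingSets.mpr hS
    · push Not at hedge
      refine ⟨[U], by simp, by simp, fun S => ?_⟩
      rw [List.mem_singleton]
      refine ⟨fun h => h ▸ G.dominatesIn_self U, fun hS => Finset.Subset.antisymm hS.1 ?_⟩
      intro x hx
      by_contra hxS
      obtain ⟨u, hu, hux⟩ := hS.2 x hx hxS
      exact hedge u (hS.1 hu) x hx hux

/-- The TARS-graph of a finite acyclic graph is pancyclic. -/
theorem IsAcyclic.isPancyclic_tarsGraph [Fintype V] (hG : G.IsAcyclic) :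
    G.tarsGraph.IsPancyclic := by
  intro n hn hncard
  have hdom : ∀ S, G.IsDominating S ↔ G.DominatesIn Finset.univ S := by
    simp [IsDominating, DominatesIn]
  have hcard : Nat.card {S : Finset V // G.IsDominating S} =
      (G.dominatingSets Finset.univ).card := by
    rw [← Nat.card_eq_finsetCard]
    exact Nat.card_congr (Equiv.subtypeEquivRight fun S =>
      (hdom S).trans mem_dominatingSets.symm)
  by_cases hedge : ∃ a b, G.Adj a b
  · obtain ⟨a, b, hab⟩ := hedge
    obtain ⟨v, hv, w, h1, ⟨l, hlU, hvl, hlw⟩, h3⟩ := hG.exists_support_in Finset.univ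
      (Finset.mem_univ a) (Finset.mem_univ b) hab
    have h : G.IsSupport Finset.univ v w := ⟨hv, h1, ⟨l, hlU, hvl, hlw⟩, h3⟩
    have hl : l ∈ G.leaves Finset.univ v w := IsSupport.mem_leaves.mpr ⟨hlU, hvl, hlw⟩
    obtain ⟨Qs, hnd, hch, hmem⟩ := hG.exists_hamiltonian_path (G.core Finset.univ v w)
    obtain ⟨X, Y, hYX, hpath⟩ := h.exists_cycle hl hnd hch hmem hn
      ((hncard.trans_eq hcard).trans (h.card_dominatingSets_le hl hnd hmem))
    have hX : G.IsDominating X := (hdom X).mpr hpath.left_mem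
    have hY : G.IsDominating Y := (hdom Y).mpr (hpath.symm fun _ _ => TarsRel.symm).left_mem
    classical
    -- The value `⟨X, hX⟩` off the dominating sets is arbitrary; the path never leaves them.
    let f : Finset V → {S : Finset V // G.IsDominating S} := fun S =>
      if hS : G.IsDominating S then ⟨S, hS⟩ else ⟨X, hX⟩
    have hf : ∀ S, G.DominatesIn Finset.univ S → (f S).1 = S := by
      intro S hS
      simp only [f, dif_pos ((hdom S).mpr hS)]
    have hadj : ∀ S, G.DominatesIn Finset.univ S → ∀ S', G.DominatesIn Finset.univ S' →
        G.TarsRel S S' → G.tarsGraph.Adj (f S) (f S') := by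
      intro S hS S' hS' hSS'
      change G.TarsRel (f S).1 (f S').1
      rwa [hf S hS, hf S' hS']
    refine exists_isCycle_of_hasPath (hpath.map f ?_ hadj)
      (hadj Y ((hdom Y).mp hY) X ((hdom X).mp hX) hYX) hn
    intro S hS S' hS' hSS'
    rw [← hf S hS, hSS', hf S' hS']
  -- Without edges the whole vertex set is the only dominating set, so no length has to be realised.
  · push Not at hedge
    have huniv : ∀ S, G.IsDominating S → S = Finset.univ := by
      intro S hS
      rw [Finset.eq_univ_iff_forall]
      intro x
      by_contra hx
      obtain ⟨u, -, hux⟩ := hS x hx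
      exact hedge u x hux
    have : Subsingleton {S : Finset V // G.IsDominating S} :=
      ⟨fun S S' => Subtype.ext ((huniv S S.2).trans (huniv S' S'.2).symm)⟩
    have := Finite.card_le_one_iff_subsingleton.mpr this
    omega

end SimpleGraph

theorem mainTheorem1 {V : Type*} [Fintype V] [DecidableEq V] (T : SimpleGraph V)
    (hT : T.IsTree) : T.tarsGraph.IsPancyclic :=
  hT.isAcyclic.isPancyclic_tarsGraph
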